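/- Let $\mathbb{G}$ be a compact quantum group in the sense of Woronowicz, given by a unital C*-algebra $A=C(\mathbb{G})\neq 0$ and a coassociative unital $*$-homomorphism $\Delta:A\to A\otimes_{\min}A$ such that $\Delta(A)(A\otimes 1)$ and $\Delta(A)(1\otimes A)$ are linearly dense in $A\otimes_{\min}A$. Let $\Gamma=\widehat{\mathbb{G}}$ be the dual discrete quantum group, and let $\mathbb{C}[\Gamma]=\mathrm{Pol}(\mathbb{G})\subseteq A$ be the $*$-subalgebra generated by the matrix coefficients of the finite-dimensional unitary representations of $\mathbb{G}$. Let $\mathrm{Irr}(\mathbb{G})$ be the set of equivalence classes of irreducible finite-dimensional unitary representations of $\mathbb{G}$. For $I\subseteq\mathrm{Irr}(\mathbb{G})$, let $\langle I\rangle$ be the smallest subset of $\mathrm{Irr}(\mathbb{G})$ that contains $I$ and the trivial class, is closed under conjugation, and contains with $\alpha,\beta$ every irreducible constituent of $\alpha\otimes\beta$ (the irreducibles of the fusion ring generated by $I$). Call $\Gamma$ *locally finite* if $\langle I\rangle$ is finite for every finite $I\subseteq\mathrm{Irr}(\mathbb{G})$. Call $\Gamma$ (or $\mathbb{C}[\Gamma]$)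 *C\*-unique* if there is exactly one pre-C*-norm on $\mathbb{C}[\Gamma]$, that is, exactly one submultiplicative norm with $\|x^*x\|=\|x\|^2$ for all $x$. **Proposition.** If $\Gamma$ is locally finite, then $\mathbb{C}[\Gamma]$ is C*-unique. -/

import Mathlib

open scoped TensorProduct Kronecker

/-! ### Minimal tensor products -/

section MinimalTensor

variable {H K : Type*} [NormedAddCommGroup H] [InnerProductSpace ℂ H]
  [NormedAddCommGroup K] [InnerProductSpace ℂ K]

/-- The Hilbert space tensor product of `H` and `K`: the completion of the algebraic tensor
product for the inner product `⟪x ⊗ y, x' ⊗ y'⟫ = ⟪x, x'⟫ * ⟪y, y'⟫`. -/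
def HilbertTensor (H K : Type*) [NormedAddCommGroup H] [InnerProductSpace ℂ H]
    [NormedAddCommGroup K] [InnerProductSpace ℂ K] : Type _ :=
  UniformSpace.Completion (H ⊗[ℂ] K)

noncomputable instance : NormedAddCommGroup (HilbertTensor H K) :=
  inferInstanceAs (NormedAddCommGroup (UniformSpace.Completion (H ⊗[ℂ] K)))

noncomputable instance : InnerProductSpace ℂ (HilbertTensor H K) :=
  inferInstanceAs (InnerProductSpace ℂ (UniformSpace.Completion (H ⊗[ℂ] K)))

instance : CompleteSpace (HilbertTensor H K) :=
  inferInstanceAs (CompleteSpace (UniformSpace.Completion (H ⊗[ℂ] K)))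

/-- The canonical (isometric, dense) embedding of the algebraic tensor product. -/
noncomputable def HilbertTensor.of : H ⊗[ℂ] K →L[ℂ] HilbertTensor H K :=
  UniformSpace.Completion.toComplL (𝕜 := ℂ) (E := H ⊗[ℂ] K)

theorem HilbertTensor.denseRange_of :
    DenseRange (HilbertTensor.of : H ⊗[ℂ] K →L[ℂ] HilbertTensor H K) :=
  UniformSpace.Completion.denseRange_coe

theorem HilbertTensor.norm_of (z : H ⊗[ℂ] K) : ‖HilbertTensor.of z‖ = ‖z‖ :=
  UniformSpace.Completion.norm_coe z

/-- The tensor product `S ⊗ T` of two bounded operators, acting on the Hilbert space tensor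
product by `(S ⊗ T) (x ⊗ y) = S x ⊗ T y`. -/
noncomputable def opTensor (S : H →L[ℂ] H) (T : K →L[ℂ] K) :
    HilbertTensor H K →L[ℂ] HilbertTensor H K :=
  ContinuousLinearMap.completion (TensorProduct.mapL S T)

theorem opTensor_of (S : H →L[ℂ] H) (T : K →L[ℂ] K) (z : H ⊗[ℂ] K) :
    opTensor S T (HilbertTensor.of z) = HilbertTensor.of (TensorProduct.mapL S T z) :=
  ContinuousLinearMap.completion_apply_coe _ _

theorem opTensor_of_tmul (S : H →L[ℂ] H) (T : K →L[ℂ] K) (x : H) (y : K) :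
    opTensor S T (HilbertTensor.of (x ⊗ₜ[ℂ] y)) = HilbertTensor.of (S x ⊗ₜ[ℂ] T y) :=
  opTensor_of S T (x ⊗ₜ[ℂ] y)

variable [CompleteSpace H] [CompleteSpace K]
  {A B : Type*} [Ring A] [StarRing A] [Algebra ℂ A] [Ring B] [StarRing B] [Algebra ℂ B]

/-- The spatial tensor product of `A` and `B`, formed by means of representations `π` of `A` on `H`
and `ρ` of `B` on `K`: the norm closed `*`-algebra of operators on the Hilbert space tensor product
generated by the operators `π a ⊗ ρ b`. When `A` and `B` are C*-algebras and `π` and `ρ` are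
faithful, this is the minimal C*-tensor product of `A` and `B`. -/
noncomputable def MinTensor (π : A →⋆ₐ[ℂ] (H →L[ℂ] H)) (ρ : B →⋆ₐ[ℂ] (K →L[ℂ] K)) :
    StarSubalgebra ℂ (HilbertTensor H K →L[ℂ] HilbertTensor H K) :=
  (StarAlgebra.adjoin ℂ {X | ∃ a b, X = opTensor (π a) (ρ b)}).topologicalClosure

/-- The elementary tensor `a ⊗ b` in the spatial tensor product. -/
noncomputable def MinTensor.tmul (π : A →⋆ₐ[ℂ] (H →L[ℂ] H)) (ρ : B →⋆ₐ[ℂ] (K →L[ℂ] K))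
    (a : A) (b : B) : MinTensor π ρ :=
  ⟨opTensor (π a) (ρ b), StarSubalgebra.le_topologicalClosure _
    (StarAlgebra.subset_adjoin ℂ _ ⟨a, b, rfl⟩)⟩

end MinimalTensor

/-! ### Compact quantum groups -/

/-- A compact quantum group `𝔾` in the sense of Woronowicz, with `C(𝔾) = A`: a comultiplication
on the unital C*-algebra `A` which is coassociative and satisfies the cancellation (density)
conditions. The faithful representation `rep` of `A` on the Hilbert space `H` serves to
form the minimal tensor product of `A` with itself (which does not depend on it). The dual of `𝔾`
is a discrete quantum group, and every discrete quantum group is of this form. -/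
structure CompactQuantumGroup (A : Type*) [CStarAlgebra A] (H : Type*) [NormedAddCommGroup H]
    [InnerProductSpace ℂ H] [CompleteSpace H] where
  /-- a faithful representation of `A` -/
  rep : A →⋆ₐ[ℂ] (H →L[ℂ] H)
  rep_injective : Function.Injective rep
  /-- the comultiplication `Δ : A → A ⊗ A` -/
  comul : A →⋆ₐ[ℂ] MinTensor rep rep
  /-- Coassociativity `(Δ ⊗ id) Δ = (id ⊗ Δ) Δ`. Here `D₁ = Δ ⊗ id`, `D₂ = id ⊗ Δ` and the
  associativity isomorphism `α` are the unique `*`-homomorphisms with the displayed values on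
  elementary tensors. -/
  coassoc : ∃ (D₁ : MinTensor rep rep →⋆ₐ[ℂ] MinTensor (MinTensor rep rep).subtype rep)
      (D₂ : MinTensor rep rep →⋆ₐ[ℂ] MinTensor rep (MinTensor rep rep).subtype)
      (α : MinTensor (MinTensor rep rep).subtype rep →⋆ₐ[ℂ]
        MinTensor rep (MinTensor rep rep).subtype),
      (∀ a b, D₁ (MinTensor.tmul rep rep a b) = MinTensor.tmul _ rep (comul a) b) ∧
      (∀ a b, D₂ (MinTensor.tmul rep rep a b) = MinTensor.tmul rep _ a (comul b)) ∧
      (∀ a b c, α (MinTensor.tmul _ rep (MinTensor.tmul rep rep a b) c) =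
        MinTensor.tmul rep _ a (MinTensor.tmul rep rep b c)) ∧
      ∀ a, α (D₁ (comul a)) = D₂ (comul a)
  /-- `Δ(A) (A ⊗ 1)` is linearly dense in `A ⊗ A`. -/
  dense_left : Dense (Submodule.span ℂ
    {x | ∃ a b, x = comul a * MinTensor.tmul rep rep b 1} : Set (MinTensor rep rep))
  /-- `Δ(A) (1 ⊗ A)` is linearly dense in `A ⊗ A`. -/
  dense_right : Dense (Submodule.span ℂ
    {x | ∃ a b, x = comul a * MinTensor.tmul rep rep 1 b} : Set (MinTensor rep rep))

/-- `T` is an intertwiner from `u` to `v`: a scalar matrix with `T u = v T`. -/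
def IsIntertwiner {A : Type*} [Ring A] [Algebra ℂ A] {ι κ : Type*} [Fintype ι] [Fintype κ]
    (T : Matrix κ ι ℂ) (u : Matrix ι ι A) (v : Matrix κ κ A) : Prop :=
  T.map (algebraMap ℂ A) * u = v * T.map (algebraMap ℂ A)

namespace CompactQuantumGroup

variable {A : Type*} [CStarAlgebra A] {H : Type*} [NormedAddCommGroup H]
  [InnerProductSpace ℂ H] [CompleteSpace H] (G : CompactQuantumGroup A H)

/-- `u` is a finite-dimensional unitary representation of `𝔾`: a unitary matrix over `A` with
`Δ (u i j) = ∑ k, u i k ⊗ u k j`. -/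
def IsUnitaryRep {n : ℕ} (u : Matrix (Fin n) (Fin n) A) : Prop :=
  u ∈ unitary (Matrix (Fin n) (Fin n) A) ∧
    ∀ i j, G.comul (u i j) = ∑ k, MinTensor.tmul G.rep G.rep (u i k) (u k j)

/-- The `*`-algebra `Pol(𝔾)`, that is, the quantum group ring of the dual discrete quantum group:
the `*`-subalgebra of `A` generated by the matrix coefficients of the finite-dimensional unitary
representations of `𝔾` (it is in fact their linear span). -/
noncomputable def pol : StarSubalgebra ℂ A :=
  StarAlgebra.adjoin ℂ {a | ∃ (n : ℕ) (u : Matrix (Fin n) (Fin n) A),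
    G.IsUnitaryRep u ∧ ∃ i j, a = u i j}

/-- An irreducible unitary representation of `𝔾`: a non-zero finite-dimensional unitary
representation whose only self-intertwiners are the scalars. -/
structure IrrRep where
  /-- the dimension -/
  dim : ℕ
  /-- the matrix -/
  mat : Matrix (Fin dim) (Fin dim) A
  isUnitaryRep : G.IsUnitaryRep mat
  dim_pos : 0 < dim
  scalar : ∀ T : Matrix (Fin dim) (Fin dim) ℂ, IsIntertwiner T mat mat → ∃ c : ℂ, T = c • 1

variable {G}

/-- Equivalence of irreducible representations: there is an invertible intertwiner. -/
instance IrrRep.setoid : Setoid G.IrrRep where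
  r u v := ∃ (T : Matrix (Fin v.dim) (Fin u.dim) ℂ) (T' : Matrix (Fin u.dim) (Fin v.dim) ℂ),
    T * T' = 1 ∧ T' * T = 1 ∧ IsIntertwiner T u.mat v.mat
  iseqv :=
    { refl := fun u => ⟨1, 1, by simp, by simp, by simp [IsIntertwiner]⟩
      symm := by
        rintro u v ⟨T, T', h, h', hT⟩
        refine ⟨T', T, h', h, ?_⟩
        have e : T.map (algebraMap ℂ A) * T'.map (algebraMap ℂ A) = 1 := by
          rw [← Matrix.map_mul, h]; simp
        have e' : T'.map (algebraMap ℂ A) * T.map (algebraMap ℂ A) = 1 := by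
          rw [← Matrix.map_mul, h']; simp
        unfold IsIntertwiner at hT ⊢
        calc T'.map (algebraMap ℂ A) * v.mat
            = T'.map (algebraMap ℂ A) * (v.mat * T.map (algebraMap ℂ A)) *
                T'.map (algebraMap ℂ A) := by
              rw [Matrix.mul_assoc, Matrix.mul_assoc v.mat, e, Matrix.mul_one]
          _ = u.mat * T'.map (algebraMap ℂ A) := by
              rw [← hT, ← Matrix.mul_assoc, e', Matrix.one_mul]
      trans := by
        rintro u v w ⟨T, T', h, h', hT⟩ ⟨S, S', k, k', hS⟩
        refine ⟨S * T, T' * S', ?_, ?_, ?_⟩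
        · rw [Matrix.mul_assoc, ← Matrix.mul_assoc T, h, Matrix.one_mul, k]
        · rw [Matrix.mul_assoc, ← Matrix.mul_assoc S', k', Matrix.one_mul, h']
        · unfold IsIntertwiner at hT hS ⊢
          rw [Matrix.map_mul, Matrix.mul_assoc, hT, ← Matrix.mul_assoc, hS, Matrix.mul_assoc] }

variable (G)

/-- `Irr(𝔾)`: the set of equivalence classes of irreducible unitary representations. -/
def Irr : Type _ := Quotient (IrrRep.setoid (G := G))

variable {G}

/-- `u` is one-dimensional with matrix `1`, that is, the trivial representation. -/
def IrrRep.IsTrivial (u : G.IrrRep) : Prop :=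
  u.dim = 1 ∧ u.mat = 1

/-- The irreducible representation `w` is contained in the tensor product of `u` and `v`, which is
the matrix with entries `u i j * v k l`: there is a non-zero intertwiner. -/
def IrrRep.InTensor (w u v : G.IrrRep) : Prop :=
  ∃ T : Matrix (Fin u.dim × Fin v.dim) (Fin w.dim) ℂ, T ≠ 0 ∧
    IsIntertwiner T w.mat (Matrix.kronecker u.mat v.mat)

/-- `w` is conjugate to `u`: it is equivalent to the entrywise adjoint of `u`. -/
def IrrRep.IsConj (w u : G.IrrRep) : Prop :=
  ∃ (T : Matrix (Fin u.dim) (Fin w.dim) ℂ) (T' : Matrix (Fin w.dim) (Fin u.dim) ℂ),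
    T * T' = 1 ∧ T' * T = 1 ∧ IsIntertwiner T w.mat (u.mat.map star)

/-- A set of classes of irreducible representations is the basis of a fusion subring if it
contains the trivial class and is closed under passing to irreducible constituents of tensor
products and under conjugation. -/
structure IsFusionClosed (S : Set G.Irr) : Prop where
  one_mem : ∀ u : G.IrrRep, u.IsTrivial → (⟦u⟧ : Quotient IrrRep.setoid) ∈ S
  tensor_mem : ∀ u v w : G.IrrRep, (⟦u⟧ : Quotient IrrRep.setoid) ∈ S →
    (⟦v⟧ : Quotient IrrRep.setoid) ∈ S → w.InTensor u v → (⟦w⟧ : Quotient IrrRep.setoid) ∈ S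
  conj_mem : ∀ u w : G.IrrRep, (⟦u⟧ : Quotient IrrRep.setoid) ∈ S → w.IsConj u →
    (⟦w⟧ : Quotient IrrRep.setoid) ∈ S

/-- The set of irreducible classes of the fusion ring generated by `I`. -/
def fusionClosure (I : Set G.Irr) : Set G.Irr :=
  ⋂₀ {S | I ⊆ S ∧ IsFusionClosed S}

variable (G)

/-- The discrete quantum group dual to `𝔾` is locally finite: every finite set of irreducible
representations of `𝔾` generates a finite fusion ring. -/
def DualLocallyFinite : Prop :=
  ∀ I : Set G.Irr, I.Finite → (fusionClosure I).Finite

end CompactQuantumGroup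

/-- A pre-C*-norm on a complex `*`-algebra: a submultiplicative norm satisfying the C*-identity. -/
def IsPreCStarNorm {P : Type*} [Ring P] [StarRing P] [Algebra ℂ P] (p : AlgebraNorm ℂ P) : Prop :=
  ∀ x : P, p (star x * x) = p x ^ 2

/-- The discrete quantum group dual to `𝔾` is C*-unique: its quantum group ring has one and only
one pre-C*-norm. -/
def CompactQuantumGroup.DualCStarUnique {A : Type*} [CStarAlgebra A] {H : Type*}
    [NormedAddCommGroup H] [InnerProductSpace ℂ H] [CompleteSpace H]
    (G : CompactQuantumGroup A H) : Prop :=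
  ∃! p : AlgebraNorm ℂ G.pol, IsPreCStarNorm p

/-! ### Calculus of operator tensors and the two legs of the minimal tensor product -/

section MinimalTensor

variable {H K : Type*} [NormedAddCommGroup H] [InnerProductSpace ℂ H]
  [NormedAddCommGroup K] [InnerProductSpace ℂ K]

/-! Existence is free: the norm of `A` restricts to a pre-C*-norm on Pol(𝔾). For uniqueness, each
element of Pol(𝔾) lies in a finite-dimensional `*`-algebra, the coefficient span of a finite
fusion-closed set. Two norms `p`, `q` satisfy `p ≤ C q` there, and on a self-adjoint `a` the
C*-identity gives `p (a ^ 2 ^ n) = p a ^ 2 ^ n`, so taking roots removes `C`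
(`IsPreCStarNorm.le_of_mem`).

The span is an algebra because a product of coefficients is a coefficient of a tensor product, and
representations decompose into irreducibles (`IsRepOn.mem_constituentSpan`): a non-scalar
self-intertwiner yields a Hermitian one, whose spectral projections split the representation. No
Haar state is needed. Closure under the adjoint comes from finite dimension: `uᴴ` is the inverse of
`u`, hence has entries in any finite-dimensional algebra containing those of `u`. -/

theorem HilbertTensor.clm_ext {S T : HilbertTensor H K →L[ℂ] HilbertTensor H K}
    (h : ∀ z : H ⊗[ℂ] K, S (HilbertTensor.of z) = T (HilbertTensor.of z)) : S = T :=
  DFunLike.coe_injective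
    (HilbertTensor.denseRange_of.equalizer S.continuous T.continuous (funext h))

theorem opTensor_one : opTensor (1 : H →L[ℂ] H) (1 : K →L[ℂ] K) = 1 := by
  refine HilbertTensor.clm_ext fun z => ?_
  rw [opTensor_of, TensorProduct.mapL_apply]
  exact congrArg _ (LinearMap.congr_fun TensorProduct.map_id z)

theorem opTensor_mul (S S' : H →L[ℂ] H) (T T' : K →L[ℂ] K) :
    opTensor (S * S') (T * T') = opTensor S T * opTensor S' T' := by
  refine HilbertTensor.clm_ext fun z => ?_
  rw [mul_apply_eq_comp, opTensor_of, opTensor_of, opTensor_of,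
    TensorProduct.mapL_apply, TensorProduct.mapL_apply, TensorProduct.mapL_apply]
  exact congrArg _ (LinearMap.congr_fun (TensorProduct.map_comp _ _ _ _) z)

theorem opTensor_add_left (S S' : H →L[ℂ] H) (T : K →L[ℂ] K) :
    opTensor (S + S') T = opTensor S T + opTensor S' T := by
  refine HilbertTensor.clm_ext fun z => ?_
  rw [_root_.add_apply, opTensor_of, opTensor_of, opTensor_of,
    TensorProduct.mapL_apply, TensorProduct.mapL_apply, TensorProduct.mapL_apply, ← map_add]
  exact congrArg _ (LinearMap.congr_fun (TensorProduct.map_add_left _ _ _) z)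

theorem opTensor_add_right (S : H →L[ℂ] H) (T T' : K →L[ℂ] K) :
    opTensor S (T + T') = opTensor S T + opTensor S T' := by
  refine HilbertTensor.clm_ext fun z => ?_
  rw [_root_.add_apply, opTensor_of, opTensor_of, opTensor_of,
    TensorProduct.mapL_apply, TensorProduct.mapL_apply, TensorProduct.mapL_apply, ← map_add]
  exact congrArg _ (LinearMap.congr_fun (TensorProduct.map_add_right _ _ _) z)

theorem opTensor_smul_left (c : ℂ) (S : H →L[ℂ] H) (T : K →L[ℂ] K) :
    opTensor (c • S) T = c • opTensor S T := by
  refine HilbertTensor.clm_ext fun z => ?_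
  rw [_root_.smul_apply, opTensor_of, opTensor_of,
    TensorProduct.mapL_apply, TensorProduct.mapL_apply, ← map_smul]
  exact congrArg _ (LinearMap.congr_fun (TensorProduct.map_smul_left _ _ _) z)

theorem opTensor_smul_right (c : ℂ) (S : H →L[ℂ] H) (T : K →L[ℂ] K) :
    opTensor S (c • T) = c • opTensor S T := by
  refine HilbertTensor.clm_ext fun z => ?_
  rw [_root_.smul_apply, opTensor_of, opTensor_of,
    TensorProduct.mapL_apply, TensorProduct.mapL_apply, ← map_smul]
  exact congrArg _ (LinearMap.congr_fun (TensorProduct.map_smul_right _ _ _) z)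

variable [CompleteSpace H] [CompleteSpace K]
  {A B : Type*} [Ring A] [StarRing A] [Algebra ℂ A] [Ring B] [StarRing B] [Algebra ℂ B]

namespace MinTensor

variable (π : A →⋆ₐ[ℂ] (H →L[ℂ] H)) (ρ : B →⋆ₐ[ℂ] (K →L[ℂ] K))

theorem tmul_one_one : tmul π ρ 1 1 = 1 :=
  Subtype.ext (by
    change opTensor (π 1) (ρ 1) = 1
    rw [map_one, map_one, opTensor_one])

theorem tmul_mul_tmul (a a' : A) (b b' : B) :
    tmul π ρ a b * tmul π ρ a' b' = tmul π ρ (a * a') (b * b') :=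
  Subtype.ext (by
    change opTensor (π a) (ρ b) * opTensor (π a') (ρ b') = opTensor (π (a * a')) (ρ (b * b'))
    rw [map_mul, map_mul, opTensor_mul])

/-- The homomorphism `a ↦ a ⊗ 1`. -/
noncomputable def inl : A →ₐ[ℂ] MinTensor π ρ :=
  AlgHom.ofLinearMap
    { toFun := fun a => tmul π ρ a 1
      map_add' := fun a a' => Subtype.ext (by
        change opTensor (π (a + a')) (ρ 1) = opTensor (π a) (ρ 1) + opTensor (π a') (ρ 1)
        rw [map_add, opTensor_add_left])
      map_smul' := fun c a => Subtype.ext (by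
        change opTensor (π (c • a)) (ρ 1) = c • opTensor (π a) (ρ 1)
        rw [map_smul, opTensor_smul_left]) }
    (tmul_one_one π ρ)
    (fun a a' => by
      change tmul π ρ (a * a') 1 = tmul π ρ a 1 * tmul π ρ a' 1
      rw [tmul_mul_tmul, mul_one])

/-- The homomorphism `b ↦ 1 ⊗ b`. -/
noncomputable def inr : B →ₐ[ℂ] MinTensor π ρ :=
  AlgHom.ofLinearMap
    { toFun := fun b => tmul π ρ 1 b
      map_add' := fun b b' => Subtype.ext (by
        change opTensor (π 1) (ρ (b + b')) = opTensor (π 1) (ρ b) + opTensor (π 1) (ρ b')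
        rw [map_add, opTensor_add_right])
      map_smul' := fun c b => Subtype.ext (by
        change opTensor (π 1) (ρ (c • b)) = c • opTensor (π 1) (ρ b)
        rw [map_smul, opTensor_smul_right]) }
    (tmul_one_one π ρ)
    (fun b b' => by
      change tmul π ρ 1 (b * b') = tmul π ρ 1 b * tmul π ρ 1 b'
      rw [tmul_mul_tmul, mul_one])

theorem inl_mul_inr (a : A) (b : B) : inl π ρ a * inr π ρ b = tmul π ρ a b := by
  change tmul π ρ a 1 * tmul π ρ 1 b = tmul π ρ a b
  rw [tmul_mul_tmul, mul_one, one_mul]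

/-- With `inl_mul_inr`, this says that the two legs commute, as tensor products of representations
require. -/
theorem inr_mul_inl (a : A) (b : B) : inr π ρ b * inl π ρ a = tmul π ρ a b := by
  change tmul π ρ 1 b * tmul π ρ a 1 = tmul π ρ a b
  rw [tmul_mul_tmul, mul_one, one_mul]

end MinTensor

end MinimalTensor

/-! ### Matrix representations, intertwiners and their splitting -/

section MatrixRep

open Matrix

variable {A M : Type*} [Ring A] [StarRing A] [Algebra ℂ A] [StarModule ℂ A] [Ring M] [Algebra ℂ M]
  {ι κ : Type*} [Fintype ι] [Fintype κ] [DecidableEq ι] [DecidableEq κ]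

/-- `u` is a unitary matrix over `A` with `(id ⊗ Δ) u = u₁₂ u₁₃`, where `Δ : A → M` is a
"comultiplication" and `L, R : A → M` play the roles of `a ↦ a ⊗ 1` and `a ↦ 1 ⊗ a`. -/
structure IsMatrixRep (Δ L R : A →ₐ[ℂ] M) (u : Matrix ι ι A) : Prop where
  mul_star_self : u * uᴴ = 1
  star_mul_self : uᴴ * u = 1
  comul : u.map Δ = u.map L * u.map R

variable {Δ L R : A →ₐ[ℂ] M} {u : Matrix ι ι A}

theorem Matrix.map_algebraMap_map (f : A →ₐ[ℂ] M) (T : Matrix ι κ ℂ) :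
    (T.map (algebraMap ℂ A)).map f = T.map (algebraMap ℂ M) := by
  ext i j
  simp

theorem Matrix.conjTranspose_map_algebraMap (T : Matrix ι κ ℂ) :
    (T.map (algebraMap ℂ A))ᴴ = Tᴴ.map (algebraMap ℂ A) := by
  ext i j
  simp [← algebraMap_star_comm]

theorem IsIntertwiner.comp {ν : Type*} [Fintype ν] {v : Matrix κ κ A} {w : Matrix ν ν A}
    {S : Matrix ν κ ℂ} {T : Matrix κ ι ℂ} (hS : IsIntertwiner S v w) (hT : IsIntertwiner T u v) :
    IsIntertwiner (S * T) u w := by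
  unfold IsIntertwiner at *
  rw [Matrix.map_mul, Matrix.mul_assoc, hT, ← Matrix.mul_assoc, hS, Matrix.mul_assoc]

/-- Take adjoints in `T u = u T`, multiply by `u` on both sides and cancel by unitarity. -/
theorem IsIntertwiner.conjTranspose (hu : IsMatrixRep Δ L R u) {T : Matrix ι ι ℂ}
    (hT : IsIntertwiner T u u) : IsIntertwiner Tᴴ u u := by
  unfold IsIntertwiner at *
  have h := congrArg (fun X => u * Xᴴ * u) hT
  simp only [conjTranspose_mul, conjTranspose_map_algebraMap] at h
  rw [← Matrix.mul_assoc u, hu.mul_star_self, Matrix.one_mul, Matrix.mul_assoc u, Matrix.mul_assoc _ uᴴ,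
    hu.star_mul_self, Matrix.mul_one] at h
  exact h

/-- The compression of a representation to an invariant subspace, the range of the isometry `V`,
is a representation. -/
theorem IsMatrixRep.compress (hu : IsMatrixRep Δ L R u) {V : Matrix ι κ ℂ} (hV : Vᴴ * V = 1)
    (hc : IsIntertwiner (V * Vᴴ) u u) :
    IsMatrixRep Δ L R (Vᴴ.map (algebraMap ℂ A) * u * V.map (algebraMap ℂ A)) ∧
      IsIntertwiner V (Vᴴ.map (algebraMap ℂ A) * u * V.map (algebraMap ℂ A)) u := by
  have hV' : Vᴴ.map (algebraMap ℂ A) * V.map (algebraMap ℂ A) = 1 := by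
    rw [← Matrix.map_mul, hV]; simp
  have hI : IsIntertwiner V (Vᴴ.map (algebraMap ℂ A) * u * V.map (algebraMap ℂ A)) u := by
    unfold IsIntertwiner at *
    rw [Matrix.map_mul] at hc
    rw [← Matrix.mul_assoc, ← Matrix.mul_assoc, hc, Matrix.mul_assoc, Matrix.mul_assoc, hV',
      Matrix.mul_one]
  refine ⟨⟨?_, ?_, ?_⟩, hI⟩
  · rw [conjTranspose_mul, conjTranspose_mul, conjTranspose_map_algebraMap,
      conjTranspose_map_algebraMap, conjTranspose_conjTranspose, ← Matrix.mul_assoc,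
      ← Matrix.mul_assoc, Matrix.mul_assoc _ (V.map _), ← Matrix.map_mul]
    unfold IsIntertwiner at hc
    rw [Matrix.mul_assoc _ u, ← hc, Matrix.map_mul, ← Matrix.mul_assoc, ← Matrix.mul_assoc, hV',
      Matrix.one_mul, Matrix.mul_assoc _ u, hu.mul_star_self, Matrix.mul_one, hV']
  · rw [conjTranspose_mul, conjTranspose_mul, conjTranspose_map_algebraMap,
      conjTranspose_map_algebraMap, conjTranspose_conjTranspose, Matrix.mul_assoc,
      Matrix.mul_assoc uᴴ, hI, ← Matrix.mul_assoc uᴴ, hu.star_mul_self, Matrix.one_mul, hV']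
  -- Compressing each leg puts the projection `V Vᴴ` between the two legs of `u`. It commutes past
  -- the right leg and is absorbed by `V`.
  · have hR : (V * Vᴴ).map (algebraMap ℂ M) * u.map R = u.map R * (V * Vᴴ).map (algebraMap ℂ M) := by
      unfold IsIntertwiner at hc
      have := congrArg (fun X => X.map R) hc
      simpa only [Matrix.map_mul, map_algebraMap_map] using this
    have hV'' : Vᴴ.map (algebraMap ℂ M) * V.map (algebraMap ℂ M) = 1 := by
      rw [← Matrix.map_mul, hV]; simp
    simp only [Matrix.map_mul, map_algebraMap_map] at hR ⊢
    rw [hu.comul]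
    simp only [Matrix.mul_assoc] at hR ⊢
    rw [← Matrix.mul_assoc (V.map _) (Vᴴ.map _), ← Matrix.mul_assoc (V.map _ * _), Matrix.mul_assoc (V.map _),
      hR]
    simp only [Matrix.mul_assoc]
    rw [hV'', Matrix.mul_one]

theorem IsMatrixRep.reindex (hu : IsMatrixRep Δ L R u) (e : κ ≃ ι) :
    IsMatrixRep Δ L R (u.submatrix e e) where
  mul_star_self := by
    rw [conjTranspose_submatrix, submatrix_mul_equiv, hu.mul_star_self, submatrix_one_equiv]
  star_mul_self := by
    rw [conjTranspose_submatrix, submatrix_mul_equiv, hu.star_mul_self, submatrix_one_equiv]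
  comul := by
    have := congrArg (fun X => X.submatrix e e) hu.comul
    simp only [← submatrix_mul_equiv _ _ e e e] at this
    exact this

/-- The tensor product of two representations. -/
theorem IsMatrixRep.kronecker (hu : IsMatrixRep Δ L R u) {v : Matrix κ κ A}
    (hv : IsMatrixRep Δ L R v) (hLR : ∀ a b, L a * R b = R b * L a) :
    IsMatrixRep Δ L R (Matrix.kronecker u v) where
  mul_star_self := by
    ext ⟨i, k⟩ ⟨j, l⟩
    have hu' : ∀ i j, ∑ x, u i x * star (u j x) = (1 : Matrix ι ι A) i j := fun i j => by
      rw [← hu.mul_star_self]; simp [mul_apply]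
    have hv' : ∀ i j, ∑ x, v i x * star (v j x) = (1 : Matrix κ κ A) i j := fun i j => by
      rw [← hv.mul_star_self]; simp [mul_apply]
    simp only [mul_apply, conjTranspose_apply, Matrix.kronecker, kroneckerMap_apply, star_mul,
      Fintype.sum_prod_type]
    have : ∀ x, ∑ y, u i x * v k y * (star (v l y) * star (u j x)) =
        u i x * (1 : Matrix κ κ A) k l * star (u j x) := fun x => by
      rw [← hv', Finset.mul_sum, Finset.sum_mul]
      simp only [mul_assoc]
    simp only [this]
    by_cases h : k = l
    · subst h; simp [hu', one_apply]
    · simp [one_apply, h]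
  star_mul_self := by
    ext ⟨i, k⟩ ⟨j, l⟩
    have hu' : ∀ i j, ∑ x, star (u x i) * u x j = (1 : Matrix ι ι A) i j := fun i j => by
      rw [← hu.star_mul_self]; simp [mul_apply]
    have hv' : ∀ i j, ∑ x, star (v x i) * v x j = (1 : Matrix κ κ A) i j := fun i j => by
      rw [← hv.star_mul_self]; simp [mul_apply]
    -- Since `star` reverses products, the `u` factors are now the adjacent ones, so the sum over
    -- the first index has to be the inner one.
    simp only [mul_apply, conjTranspose_apply, Matrix.kronecker, kroneckerMap_apply, star_mul,
      Fintype.sum_prod_type_right]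
    have : ∀ y, ∑ x, star (v y k) * star (u x i) * (u x j * v y l) =
        star (v y k) * (1 : Matrix ι ι A) i j * v y l := fun y => by
      rw [← hu', Finset.mul_sum, Finset.sum_mul]
      simp only [mul_assoc]
    simp only [this]
    by_cases h : i = j
    · subst h; simp [hv', one_apply]
    · simp [one_apply, h]
  comul := by
    ext ⟨i, k⟩ ⟨j, l⟩
    have hu' : ∀ i j, Δ (u i j) = ∑ x, L (u i x) * R (u x j) := fun i j => by
      have := congrFun (congrFun hu.comul i) j
      simpa [mul_apply] using this
    have hv' : ∀ i j, Δ (v i j) = ∑ x, L (v i x) * R (v x j) := fun i j => by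
      have := congrFun (congrFun hv.comul i) j
      simpa [mul_apply] using this
    simp only [mul_apply, map_apply, Matrix.kronecker, kroneckerMap_apply, map_mul,
      Fintype.sum_prod_type, hu', hv', Finset.sum_mul_sum]
    refine Finset.sum_congr rfl fun x _ => Finset.sum_congr rfl fun y _ => ?_
    rw [mul_assoc, ← mul_assoc (R _) (L _), ← hLR]
    simp only [mul_assoc]

/-- A representation with a non-scalar self-intertwiner has a Hermitian one. -/
theorem IsMatrixRep.exists_isHermitian (hu : IsMatrixRep Δ L R u) {T : Matrix ι ι ℂ}
    (hT : IsIntertwiner T u u) (hTs : ∀ c : ℂ, T ≠ c • 1) :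
    ∃ S : Matrix ι ι ℂ, S.IsHermitian ∧ IsIntertwiner S u u ∧ ∀ c : ℂ, S ≠ c • 1 := by
  have hT' := hT.conjTranspose hu
  unfold IsIntertwiner at *
  -- If `T + Tᴴ = c` and `i(T - Tᴴ) = d` were both scalar, then `T` would be the scalar `(c - i d) /
  -- 2`.
  by_cases h : ∃ c : ℂ, T + Tᴴ = c • 1
  · obtain ⟨c, hc⟩ := h
    refine ⟨Complex.I • (T - Tᴴ), ?_, ?_, ?_⟩
    · rw [IsHermitian, conjTranspose_smul, conjTranspose_sub, conjTranspose_conjTranspose]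
      simp [← smul_neg]
    · have : (Complex.I • (T - Tᴴ)).map (algebraMap ℂ A) =
          Complex.I • (T.map (algebraMap ℂ A) - Tᴴ.map (algebraMap ℂ A)) := by
        ext i j
        rw [map_apply, Matrix.smul_apply, Matrix.sub_apply, smul_eq_mul, map_mul, map_sub, ← Algebra.smul_def]
        rfl
      rw [this, Matrix.smul_mul, Matrix.mul_smul, Matrix.sub_mul, Matrix.mul_sub, hT, hT']
    · intro d hd
      apply hTs ((2 : ℂ)⁻¹ * (c - Complex.I * d))
      have h2 : T - Tᴴ = (-Complex.I * d) • (1 : Matrix ι ι ℂ) := by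
        rw [mul_smul, ← hd, smul_smul]; simp
      have h3 : T = (2 : ℂ)⁻¹ • ((T + Tᴴ) + (T - Tᴴ)) := by
        rw [add_add_sub_cancel, ← two_smul ℂ T, smul_smul]; simp
      rw [h3, hc, h2, ← add_smul, smul_smul]
      ring_nf
  · push Not at h
    refine ⟨T + Tᴴ, ?_, ?_, h⟩
    · rw [IsHermitian, conjTranspose_add, conjTranspose_conjTranspose, add_comm]
    · rw [Matrix.map_add _ (map_add _), Matrix.add_mul, Matrix.mul_add, hT, hT']

/-- A change of orthonormal basis. It serves to pass to an eigenbasis of a Hermitian intertwiner and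
to carry spectral projections back. -/
theorem isIntertwiner_conj_iff (u : Matrix ι ι A) {U : Matrix ι ι ℂ} (hU : U * Uᴴ = 1)
    (hU' : Uᴴ * U = 1) (X : Matrix ι ι ℂ) :
    IsIntertwiner (U * X * Uᴴ) u u ↔
      IsIntertwiner X (Uᴴ.map (algebraMap ℂ A) * u * U.map (algebraMap ℂ A))
        (Uᴴ.map (algebraMap ℂ A) * u * U.map (algebraMap ℂ A)) := by
  unfold IsIntertwiner
  have h1 : U.map (algebraMap ℂ A) * Uᴴ.map (algebraMap ℂ A) = 1 := by
    rw [← Matrix.map_mul, hU]; simp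
  have h2 : Uᴴ.map (algebraMap ℂ A) * U.map (algebraMap ℂ A) = 1 := by
    rw [← Matrix.map_mul, hU']; simp
  simp only [Matrix.map_mul]
  generalize U.map (algebraMap ℂ A) = V at *
  generalize Uᴴ.map (algebraMap ℂ A) = W at *
  generalize X.map (algebraMap ℂ A) = Y at *
  constructor
  · intro h
    calc Y * (W * u * V) = W * V * Y * W * u * V := by rw [h2]; simp only [Matrix.one_mul, Matrix.mul_assoc]
      _ = W * (V * Y * W * u) * V := by simp only [Matrix.mul_assoc]
      _ = W * u * V * Y * (W * V) := by rw [h]; simp only [Matrix.mul_assoc]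
      _ = W * u * V * Y := by rw [h2, Matrix.mul_one]
  · intro h
    calc V * Y * W * u = V * Y * W * u * (V * W) := by rw [h1, Matrix.mul_one]
      _ = V * (Y * (W * u * V)) * W := by simp only [Matrix.mul_assoc]
      _ = V * W * u * (V * Y * W) := by rw [h]; simp only [Matrix.mul_assoc]
      _ = u * (V * Y * W) := by rw [h1, Matrix.one_mul]

/-- The `(i, j)` entry of the commutator is `(f i - f j) • u i j`. -/
theorem isIntertwiner_diagonal_iff (u : Matrix ι ι A) (f : ι → ℂ) :
    IsIntertwiner (diagonal f) u u ↔ ∀ i j, f i ≠ f j → u i j = 0 := by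
  have hf : (diagonal f).map (algebraMap ℂ A) = diagonal fun i => algebraMap ℂ A (f i) := by
    rw [diagonal_map (map_zero _)]
  unfold IsIntertwiner
  rw [hf, ← Matrix.ext_iff]
  refine forall_congr' fun i => forall_congr' fun j => ?_
  rw [diagonal_mul, mul_diagonal, ← Algebra.commutes, ← Algebra.smul_def, ← Algebra.smul_def,
    ← sub_eq_zero, ← sub_smul]
  constructor
  · intro h hij
    have := congrArg (fun x => (f i - f j)⁻¹ • x) h
    simpa only [smul_zero, smul_smul, inv_mul_cancel₀ (sub_ne_zero.2 hij), one_smul] using this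
  · intro h
    by_cases hij : f i = f j
    · rw [hij, sub_self, zero_smul]
    · rw [h hij, smul_zero]

/-- The isometric inclusion of the coordinate subspace given by `q`. -/
def coordInclusion (q : ι → Prop) : Matrix ι {i // q i} ℂ :=
  (1 : Matrix ι ι ℂ).submatrix id (↑)

theorem conjTranspose_mul_coordInclusion (q : ι → Prop) :
    (coordInclusion q)ᴴ * coordInclusion q = 1 := by
  ext i j
  simp [coordInclusion, mul_apply, one_apply, Subtype.ext_iff, eq_comm]

theorem coordInclusion_mul_conjTranspose (q : ι → Prop) [DecidablePred q] :
    coordInclusion q * (coordInclusion q)ᴴ = diagonal fun i => if q i then (1 : ℂ) else 0 := by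
  ext i j
  simp only [coordInclusion, mul_apply, one_apply, diagonal_apply, conjTranspose_apply,
    submatrix_apply, id]
  by_cases hq : q i
  · rw [Finset.sum_eq_single ⟨i, hq⟩]
    · by_cases h : i = j
      · simp [h, h ▸ hq]
      · simp [h, Ne.symm h]
    · intro b _ hb
      have : i ≠ b := fun h => hb (Subtype.ext h.symm)
      simp [this]
    · simp
  · rw [Finset.sum_eq_zero]
    · simp [hq]
    · intro b _
      have : i ≠ b := fun h => hq (h ▸ b.2)
      simp [this]

theorem Matrix.IsHermitian.exists_eq_conj_diagonal {S : Matrix ι ι ℂ} (hS : S.IsHermitian) :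
    ∃ (U : Matrix ι ι ℂ) (d : ι → ℂ), U * Uᴴ = 1 ∧ Uᴴ * U = 1 ∧ S = U * diagonal d * Uᴴ := by
  refine ⟨hS.eigenvectorUnitary, RCLike.ofReal ∘ hS.eigenvalues,
    Unitary.mul_star_self_of_mem hS.eigenvectorUnitary.2,
    Unitary.star_mul_self_of_mem hS.eigenvectorUnitary.2, ?_⟩
  have := hS.spectral_theorem
  rw [Unitary.conjStarAlgAut_apply] at this
  exact this

/-- A matrix with a non-scalar Hermitian self-intertwiner commutes with the projections onto two
non-trivial orthogonal complementary subspaces. -/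
theorem exists_isometries_of_isHermitian (u : Matrix ι ι A) {S : Matrix ι ι ℂ}
    (hS : S.IsHermitian) (hSu : IsIntertwiner S u u) (hSs : ∀ c : ℂ, S ≠ c • 1) :
    ∃ (p : ι → Prop) (_ : DecidablePred p) (V : Matrix ι {i // p i} ℂ) (W : Matrix ι {i // ¬ p i} ℂ),
      (∃ i, p i) ∧ (∃ i, ¬ p i) ∧ Vᴴ * V = 1 ∧ Wᴴ * W = 1 ∧ V * Vᴴ + W * Wᴴ = 1 ∧
      IsIntertwiner (V * Vᴴ) u u ∧ IsIntertwiner (W * Wᴴ) u u := by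
  obtain ⟨U, d, hU, hU', hSD⟩ := hS.exists_eq_conj_diagonal
  -- In an eigenbasis of `S`, the matrix `u` has no entries between distinct eigenspaces. Hence
  -- every coordinate projection that is constant on eigenspaces commutes with it.
  have hzero := (isIntertwiner_diagonal_iff _ d).1
    ((isIntertwiner_conj_iff u hU hU' (diagonal d)).1 (hSD ▸ hSu))
  obtain ⟨i₀, j₀, hij⟩ : ∃ i j, d i ≠ d j := by
    by_contra! h
    rcases isEmpty_or_nonempty ι with hι | ⟨⟨i⟩⟩
    · exact hSs 0 (Subsingleton.elim _ _)
    · apply hSs (d i)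
      have : diagonal d = d i • (1 : Matrix ι ι ℂ) := by
        rw [smul_one_eq_diagonal]
        exact congrArg diagonal (funext fun j => h j i)
      rw [hSD, this, Matrix.mul_smul, Matrix.mul_one, Matrix.smul_mul, hU]
  have hV : ∀ (q : ι → Prop) [DecidablePred q], (U * coordInclusion q)ᴴ * (U * coordInclusion q) = 1 := fun q _ => by
    rw [conjTranspose_mul, Matrix.mul_assoc, ← Matrix.mul_assoc Uᴴ, hU', Matrix.one_mul,
      conjTranspose_mul_coordInclusion]
  have hV' : ∀ (q : ι → Prop) [DecidablePred q], U * coordInclusion q * (U * coordInclusion q)ᴴ =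
      U * (diagonal fun i => if q i then (1 : ℂ) else 0) * Uᴴ := fun q _ => by
    rw [conjTranspose_mul, ← coordInclusion_mul_conjTranspose]
    simp only [Matrix.mul_assoc]
  have hI : ∀ (q : ι → Prop) [DecidablePred q], (∀ i j, d i = d j → (q i ↔ q j)) →
      IsIntertwiner (U * coordInclusion q * (U * coordInclusion q)ᴴ) u u := fun q _ hq => by
    rw [hV', isIntertwiner_conj_iff u hU hU', isIntertwiner_diagonal_iff]
    intro i j h
    refine hzero i j fun h' => h ?_
    simp only [hq i j h']
  have hadd : ∀ (q : ι → Prop) [DecidablePred q], U * coordInclusion q * (U * coordInclusion q)ᴴ +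
      U * coordInclusion (fun i => ¬ q i) * (U * coordInclusion fun i => ¬ q i)ᴴ = 1 := fun q _ => by
    have : (fun i => (if q i then (1 : ℂ) else 0) + if ¬ q i then 1 else 0) = fun _ => 1 := by
      funext i
      by_cases h : q i <;> simp [h]
    rw [hV', hV', ← Matrix.add_mul, ← Matrix.mul_add, diagonal_add, this, diagonal_one,
      Matrix.mul_one, hU]
  -- One eigenspace against the sum of the others; `i₀` and `j₀` witness that both are non-zero.
  obtain ⟨p, hp⟩ : ∃ p : ι → Prop, p = fun i => d i = d i₀ := ⟨_, rfl⟩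
  have hp' : ∀ i j, d i = d j → (p i ↔ p j) := fun i j h => by rw [hp]; simp only [h]
  have : DecidablePred p := Classical.decPred p
  exact ⟨p, this, U * coordInclusion p, U * coordInclusion fun i => ¬ p i,
    ⟨i₀, by rw [hp]⟩, ⟨j₀, by rw [hp]; exact Ne.symm hij⟩, hV p, hV _, hadd p, hI p hp',
    hI _ fun i j h => not_congr (hp' i j h)⟩

end MatrixRep

/-! ### Comparison of pre-C*-norms in finite dimension -/

section PreCStarNorm

/-- Expand in a basis: the coordinate functionals are bounded for the norm `q`, because `V` is
finite-dimensional. -/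
theorem AlgebraNorm.exists_bound_of_finiteDimensional {P : Type*} [Ring P] [Algebra ℂ P]
    (p q : AlgebraNorm ℂ P) (V : Submodule ℂ P) [FiniteDimensional ℂ V] :
    ∃ C : ℝ, 0 < C ∧ ∀ x ∈ V, p x ≤ C * q x := by
  let b := Module.finBasis ℂ V
  let : Norm V := ⟨fun v => q (v : P)⟩
  let core : NormedSpace.Core ℂ V :=
    { norm_nonneg := fun v => apply_nonneg q (v : P)
      norm_smul := fun c v => map_smul_eq_mul q c (v : P)
      norm_triangle := fun v w => map_add_le_add q (v : P) (w : P)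
      norm_eq_zero_iff := fun v =>
        ⟨fun h => Subtype.ext (eq_zero_of_map_eq_zero q h), fun h => by
          subst h; exact map_zero q⟩ }
  let : NormedAddCommGroup V := NormedAddCommGroup.ofCore core
  let : NormedSpace ℂ V := NormedSpace.ofCore core
  let f := fun i => LinearMap.toContinuousLinearMap (b.coord i)
  have hf : ∀ i, 0 ≤ ‖f i‖ * p (b i : P) := fun i =>
    mul_nonneg (norm_nonneg _) (apply_nonneg p _)
  -- The summand `1` only makes the constant positive, for instance when `V = 0`.
  refine ⟨1 + ∑ i, ‖f i‖ * p (b i : P), by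
    have := Finset.sum_nonneg (s := Finset.univ) fun i _ => hf i
    linarith, fun x hx => ?_⟩
  have hq : 0 ≤ q x := apply_nonneg q x
  have hx' : x = ∑ i, (f i ⟨x, hx⟩) • (b i : P) := by
    have := congrArg V.subtype (b.sum_repr ⟨x, hx⟩)
    rw [map_sum] at this
    exact this.symm
  calc p x = p (∑ i, (f i ⟨x, hx⟩) • (b i : P)) := congrArg p hx'
    _ ≤ ∑ i, p ((f i ⟨x, hx⟩) • (b i : P)) :=
        Finset.le_sum_of_subadditive p (map_zero p).le (map_add_le_add p) _ _
    _ ≤ ∑ i, ‖f i‖ * p (b i : P) * q x := Finset.sum_le_sum fun i _ => by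
        rw [map_smul_eq_mul p]
        have h : ‖f i ⟨x, hx⟩‖ ≤ ‖f i‖ * q x := (f i).le_opNorm ⟨x, hx⟩
        nlinarith [apply_nonneg p (b i : P)]
    _ = (∑ i, ‖f i‖ * p (b i : P)) * q x := (Finset.sum_mul _ _ _).symm
    _ ≤ _ := by nlinarith

variable {P : Type*} [Ring P] [StarRing P] [Algebra ℂ P]

/-- For self-adjoint `b` the C*-identity reads `p (b ^ 2) = p b ^ 2`; iterate it over repeated
squares. -/
theorem IsPreCStarNorm.map_pow_two_pow {p : AlgebraNorm ℂ P} (hp : IsPreCStarNorm p) {a : P}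
    (ha : IsSelfAdjoint a) (n : ℕ) : p (a ^ 2 ^ n) = p a ^ 2 ^ n := by
  induction n with
  | zero => simp
  | succ n ih =>
    have h := hp (a ^ 2 ^ n)
    rw [(ha.pow _).star_eq, ← pow_add, ← two_mul, ← pow_succ', ih, ← pow_mul, ← pow_succ] at h
    exact h

/-- If `b < a`, then `C * (b / a) ^ 2 ^ n` would tend to `0` while staying at least `1`. -/
theorem le_of_pow_two_pow_le {a b C : ℝ} (hb : 0 ≤ b)
    (h : ∀ n : ℕ, a ^ 2 ^ n ≤ C * b ^ 2 ^ n) : a ≤ b := by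
  by_contra! hab
  have ha : 0 < a := hb.trans_lt hab
  have h1 : b / a < 1 := (div_lt_one ha).2 hab
  have ht : Filter.Tendsto (fun n : ℕ => C * (b / a) ^ 2 ^ n) Filter.atTop (nhds (C * 0)) :=
    ((tendsto_pow_atTop_nhds_zero_of_lt_one (by positivity) h1).comp
      (tendsto_pow_atTop_atTop_of_one_lt one_lt_two)).const_mul C
  have := ge_of_tendsto' ht fun n => (show (1 : ℝ) ≤ C * (b / a) ^ 2 ^ n by
    rw [div_pow, ← mul_div_assoc, one_le_div (by positivity)]
    exact h n)
  linarith

/-- A pre-C*-norm is dominated by any other one on a finite-dimensional `*`-subalgebra. -/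
theorem IsPreCStarNorm.le_of_mem {p q : AlgebraNorm ℂ P} (hp : IsPreCStarNorm p)
    (hq : IsPreCStarNorm q) (V : Subalgebra ℂ P) [FiniteDimensional ℂ V]
    (hV : ∀ x ∈ V, star x ∈ V) {x : P} (hx : x ∈ V) : p x ≤ q x := by
  have : FiniteDimensional ℂ (Subalgebra.toSubmodule V) := ‹FiniteDimensional ℂ V›
  obtain ⟨C, -, hC⟩ := p.exists_bound_of_finiteDimensional q (Subalgebra.toSubmodule V)
  have ha : IsSelfAdjoint (star x * x) := IsSelfAdjoint.star_mul_self x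
  have haV : star x * x ∈ V := V.mul_mem (hV x hx) hx
  -- All powers of `star x * x` stay in `V`, so a single `C` serves for every `n`.
  have h : p (star x * x) ≤ q (star x * x) :=
    le_of_pow_two_pow_le (C := C) (apply_nonneg q _) fun n => by
      rw [← hp.map_pow_two_pow ha, ← hq.map_pow_two_pow ha]
      exact hC _ (V.pow_mem haV _)
  rw [hp, hq] at h
  exact (pow_le_pow_iff_left₀ (apply_nonneg p x) (apply_nonneg q x) two_ne_zero).1 h

end PreCStarNorm

/-! ### Decomposition into irreducibles and coefficient spaces -/

namespace CompactQuantumGroup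

open Matrix

variable {A : Type*} [CStarAlgebra A] {H : Type*} [NormedAddCommGroup H]
  [InnerProductSpace ℂ H] [CompleteSpace H] (G : CompactQuantumGroup A H)

/-- Unitary representations of `𝔾` on `ℂ^ι`, for an arbitrary finite type `ι`. -/
abbrev IsRepOn {ι : Type*} [Fintype ι] [DecidableEq ι] (u : Matrix ι ι A) : Prop :=
  IsMatrixRep G.comul.toAlgHom (MinTensor.inl G.rep G.rep) (MinTensor.inr G.rep G.rep) u

theorem isUnitaryRep_iff {n : ℕ} (u : Matrix (Fin n) (Fin n) A) :
    G.IsUnitaryRep u ↔ G.IsRepOn u := by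
  have h : (∀ i j, G.comul (u i j) = ∑ k, MinTensor.tmul G.rep G.rep (u i k) (u k j)) ↔
      u.map G.comul.toAlgHom =
        u.map (MinTensor.inl G.rep G.rep) * u.map (MinTensor.inr G.rep G.rep) := by
    rw [← Matrix.ext_iff]
    refine forall_congr' fun i => forall_congr' fun j => ?_
    simp only [mul_apply, map_apply, MinTensor.inl_mul_inr]
    rfl
  constructor
  · rintro ⟨hu, hc⟩
    exact ⟨Unitary.mul_star_self_of_mem hu, Unitary.star_mul_self_of_mem hu, h.1 hc⟩
  · rintro ⟨h1, h2, h3⟩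
    exact ⟨Unitary.mem_iff.2 ⟨h2, h1⟩, h.2 h3⟩

variable {G}

theorem IrrRep.isRepOn (u : G.IrrRep) : G.IsRepOn u.mat :=
  (G.isUnitaryRep_iff _).1 u.isUnitaryRep

variable (G) in
/-- The span of the coefficients of the irreducible representations contained in `u`. -/
noncomputable def constituentSpan {ι : Type*} [Fintype ι] (u : Matrix ι ι A) : Submodule ℂ A :=
  Submodule.span ℂ {a | ∃ (w : G.IrrRep) (T : Matrix ι (Fin w.dim) ℂ),
    T ≠ 0 ∧ IsIntertwiner T w.mat u ∧ ∃ k l, a = w.mat k l}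

/-- A constituent `T` of `v` gives the constituent `V * T` of `u`, non-zero because `T = Vᴴ * (V *
T)`. -/
theorem constituentSpan_mono {ι κ : Type*} [Fintype ι] [Fintype κ] [DecidableEq κ]
    {u : Matrix ι ι A} {v : Matrix κ κ A}
    {V : Matrix ι κ ℂ} (hV : Vᴴ * V = 1) (hI : IsIntertwiner V v u) :
    G.constituentSpan v ≤ G.constituentSpan u := by
  refine Submodule.span_mono ?_
  rintro a ⟨w, T, hT, hTI, k, l, rfl⟩
  refine ⟨w, V * T, fun h => hT ?_, hI.comp hTI, k, l, rfl⟩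
  rw [← Matrix.one_mul T, ← hV, Matrix.mul_assoc, h, Matrix.mul_zero]

/-- Base case of the decomposition: `u` is itself irreducible, once its index type is enumerated by
`Fin`. The enumeration, as a permutation matrix, is the intertwiner. -/
theorem IsRepOn.mem_constituentSpan_of_scalar {ι : Type*} [Fintype ι] [DecidableEq ι]
    {u : Matrix ι ι A} (hu : G.IsRepOn u)
    (h : ∀ T : Matrix ι ι ℂ, IsIntertwiner T u u → ∃ c : ℂ, T = c • 1) (i j : ι) :
    u i j ∈ G.constituentSpan u := by
  let e := (Fintype.equivFin ι).symm
  have key : ∀ S : Matrix (Fin (Fintype.card ι)) (Fin (Fintype.card ι)) ℂ,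
      IsIntertwiner S (u.submatrix e e) (u.submatrix e e) →
        IsIntertwiner (S.submatrix e.symm e.symm) u u := fun S hS => by
    unfold IsIntertwiner at *
    have := congrArg (fun X => X.submatrix e.symm e.symm) hS
    simp only [← submatrix_mul_equiv _ _ e.symm e.symm e.symm] at this
    simpa [submatrix_map] using this
  let w : G.IrrRep :=
    { dim := Fintype.card ι
      mat := u.submatrix e e
      isUnitaryRep := (G.isUnitaryRep_iff _).2 (hu.reindex e)
      dim_pos := Fintype.card_pos_iff.2 ⟨i⟩
      scalar := fun S hS => by
        obtain ⟨c, hc⟩ := h _ (key S hS)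
        refine ⟨c, ?_⟩
        have := congrArg (fun X => X.submatrix e e) hc
        simpa [submatrix_smul] using this }
  refine Submodule.subset_span ⟨w, (1 : Matrix ι ι ℂ).submatrix id e, fun h0 => ?_, ?_, e.symm i,
    e.symm j, ?_⟩
  · have h1 : (1 : Matrix ι ι ℂ) i (e (e.symm i)) = 0 := congrFun (congrFun h0 i) (e.symm i)
    rw [e.apply_symm_apply, one_apply_eq] at h1
    exact one_ne_zero h1
  · unfold IsIntertwiner
    ext a b
    have h1 : ∑ k, algebraMap ℂ A ((1 : Matrix ι ι ℂ) a (e k)) * u (e k) (e b) = u a (e b) := by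
      rw [e.sum_comp fun k => algebraMap ℂ A ((1 : Matrix ι ι ℂ) a k) * u k (e b)]
      simp [one_apply, apply_ite]
    have h2 : ∑ k, u a k * algebraMap ℂ A ((1 : Matrix ι ι ℂ) k (e b)) = u a (e b) := by
      simp [one_apply, apply_ite]
    exact h1.trans h2.symm
  · simp [w]

/-- The coefficients of a unitary representation are linear combinations of coefficients of its
irreducible constituents. -/
theorem IsRepOn.mem_constituentSpan {ι : Type*} [Fintype ι] [DecidableEq ι]
    {u : Matrix ι ι A} (hu : G.IsRepOn u) (i j : ι) : u i j ∈ G.constituentSpan u := by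
  induction hn : Fintype.card ι using Nat.strong_induction_on generalizing ι with
  | _ n ih =>
    subst hn
    by_cases h : ∀ T : Matrix ι ι ℂ, IsIntertwiner T u u → ∃ c : ℂ, T = c • 1
    · exact hu.mem_constituentSpan_of_scalar h i j
    push Not at h
    obtain ⟨T, hT, hTs⟩ := h
    obtain ⟨S, hS, hSu, hSs⟩ := hu.exists_isHermitian hT hTs
    obtain ⟨p, _, V, W, ⟨i₀, hi⟩, ⟨j₀, hj⟩, hV, hW, hVW, hVu, hWu⟩ :=
      exists_isometries_of_isHermitian u hS hSu hSs
    -- As `X Xᴴ` commutes with `u`, one has `X Xᴴ u = X (Xᴴ u X) Xᴴ`. Its entries are thus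
    -- combinations of those of the compression, which is smaller because `q` misses an index.
    have block : ∀ (q : ι → Prop) [DecidablePred q] (X : Matrix ι {i // q i} ℂ), (∃ i, ¬ q i) →
        Xᴴ * X = 1 → IsIntertwiner (X * Xᴴ) u u →
        ((X * Xᴴ).map (algebraMap ℂ A) * u) i j ∈ G.constituentSpan u := by
      intro q _ X hq hX hXu
      obtain ⟨hw, hwI⟩ := hu.compress hX hXu
      have hcard : Fintype.card {i // q i} < Fintype.card ι :=
        Fintype.card_subtype_lt hq.choose_spec
      have hmem : ∀ k l, (Xᴴ.map (algebraMap ℂ A) * u * X.map (algebraMap ℂ A)) k l ∈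
          G.constituentSpan u := fun k l =>
        constituentSpan_mono hX hwI (ih _ hcard hw k l rfl)
      have hX' : Xᴴ.map (algebraMap ℂ A) * X.map (algebraMap ℂ A) = 1 := by
        rw [← Matrix.map_mul, hX]; simp
      have : (X * Xᴴ).map (algebraMap ℂ A) * u = X.map (algebraMap ℂ A) *
          (Xᴴ.map (algebraMap ℂ A) * u * X.map (algebraMap ℂ A)) * Xᴴ.map (algebraMap ℂ A) := by
        rw [show X.map (algebraMap ℂ A) * (Xᴴ.map (algebraMap ℂ A) * u * X.map (algebraMap ℂ A)) =
          u * X.map (algebraMap ℂ A) from hwI, Matrix.mul_assoc u, ← Matrix.map_mul]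
        exact hXu
      rw [this]
      simp only [mul_apply (M := _ * _) (N := Xᴴ.map _),
        mul_apply (M := X.map (algebraMap ℂ A)), map_apply, Finset.sum_mul]
      refine Submodule.sum_mem _ fun l _ => Submodule.sum_mem _ fun k _ => ?_
      rw [← Algebra.commutes, ← Algebra.smul_def, ← Algebra.smul_def]
      exact Submodule.smul_mem _ _ (Submodule.smul_mem _ _ (hmem k l))
    have hsum : u = (V * Vᴴ).map (algebraMap ℂ A) * u + (W * Wᴴ).map (algebraMap ℂ A) * u := by
      rw [← Matrix.add_mul, ← Matrix.map_add _ (map_add _), hVW]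
      simp
    have hij := congrFun (congrFun hsum i) j
    rw [hij]
    exact Submodule.add_mem _ (block p V ⟨j₀, hj⟩ hV hVu)
      (block _ W ⟨i₀, not_not.2 hi⟩ hW hWu)

/-- The span of the coefficients of the irreducible representations with class in `S`. -/
noncomputable def coeffSpan (S : Set G.Irr) : Submodule ℂ A :=
  Submodule.span ℂ {a | ∃ u : G.IrrRep, (⟦u⟧ : Quotient IrrRep.setoid) ∈ S ∧
    ∃ i j, a = u.mat i j}

theorem coeffSpan_mono {S S' : Set G.Irr} (h : S ⊆ S') : coeffSpan S ≤ coeffSpan S' :=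
  Submodule.span_mono fun _ ⟨u, hu, x⟩ => ⟨u, h hu, x⟩

/-- Here `u = T' v T`. Hence one representative per class spans all coefficients of that class,
which makes `coeffSpan` finite-dimensional for finite sets. -/
theorem IrrRep.mem_span_of_equiv {u v : G.IrrRep} (h : u ≈ v) (i j : Fin u.dim) :
    u.mat i j ∈ Submodule.span ℂ (Set.range fun x : Fin v.dim × Fin v.dim => v.mat x.1 x.2) := by
  obtain ⟨T, T', -, hT', hI⟩ := h
  have h1 : T'.map (algebraMap ℂ A) * T.map (algebraMap ℂ A) = 1 := by
    rw [← Matrix.map_mul, hT']; simp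
  have : u.mat = T'.map (algebraMap ℂ A) * v.mat * T.map (algebraMap ℂ A) := by
    rw [Matrix.mul_assoc, ← hI, ← Matrix.mul_assoc, h1, Matrix.one_mul]
  rw [this]
  simp only [mul_apply, map_apply, Finset.sum_mul]
  refine Submodule.sum_mem _ fun l _ => Submodule.sum_mem _ fun k _ => ?_
  rw [← Algebra.commutes, ← Algebra.smul_def, ← Algebra.smul_def]
  exact Submodule.smul_mem _ _ (Submodule.smul_mem _ _ (Submodule.subset_span ⟨(k, l), rfl⟩))

theorem finiteDimensional_coeffSpan {S : Set G.Irr} (hS : S.Finite) :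
    FiniteDimensional ℂ (coeffSpan S) := by
  let r : G.Irr → G.IrrRep := Quotient.out
  have hfin : (⋃ s ∈ S, Set.range fun x : Fin (r s).dim × Fin (r s).dim =>
      (r s).mat x.1 x.2).Finite := hS.biUnion fun s _ => Set.finite_range _
  have := FiniteDimensional.span_of_finite ℂ hfin
  have hle : coeffSpan S ≤ Submodule.span ℂ (⋃ s ∈ S, Set.range
      fun x : Fin (r s).dim × Fin (r s).dim => (r s).mat x.1 x.2) := by
    refine Submodule.span_le.2 ?_
    rintro a ⟨u, hu, i, j, rfl⟩
    refine Submodule.span_mono ?_ (IrrRep.mem_span_of_equiv (v := r ⟦u⟧) ?_ i j)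
    · exact Set.subset_biUnion_of_mem (u := fun s => Set.range
        fun x : Fin (r s).dim × Fin (r s).dim => (r s).mat x.1 x.2) hu
    · exact Setoid.symm (Quotient.mk_out u)
  exact Submodule.finiteDimensional_of_le hle

theorem IsFusionClosed.fusionClosure (I : Set G.Irr) : IsFusionClosed (fusionClosure I) where
  one_mem u hu _ hS := hS.2.one_mem u hu
  tensor_mem u v w hu hv hw S hS := hS.2.tensor_mem u v w (hu S hS) (hv S hS) hw
  conj_mem u w hu hw S hS := hS.2.conj_mem u w (hu S hS) hw

theorem subset_fusionClosure (I : Set G.Irr) : I ⊆ fusionClosure I :=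
  Set.subset_sInter fun _ hS => hS.1

theorem fusionClosure_mono {I J : Set G.Irr} (h : I ⊆ J) : fusionClosure I ⊆ fusionClosure J :=
  Set.sInter_subset_sInter fun _ hS => ⟨h.trans hS.1, hS.2⟩

variable (G) in
/-- The trivial representation. -/
noncomputable def trivialRep : G.IrrRep where
  dim := 1
  mat := 1
  isUnitaryRep := by
    refine ⟨one_mem _, fun i j => ?_⟩
    have hi := Subsingleton.elim i 0
    have hj := Subsingleton.elim j 0
    subst hi hj
    simp [MinTensor.tmul_one_one]
  dim_pos := one_pos
  scalar T _ := ⟨T 0 0, by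
    ext i j
    have hi := Subsingleton.elim i 0
    have hj := Subsingleton.elim j 0
    subst hi hj
    simp⟩

theorem IsFusionClosed.one_mem_coeffSpan {S : Set G.Irr} (hS : IsFusionClosed S) :
    (1 : A) ∈ coeffSpan S :=
  Submodule.subset_span ⟨G.trivialRep, hS.one_mem _ ⟨rfl, rfl⟩, (0 : Fin 1), (0 : Fin 1),
    (one_apply_eq (α := A) (0 : Fin 1)).symm⟩

/-- The product `u i j * v k l` is an entry of the Kronecker product, whose irreducible constituents
have their classes in `S`. -/
theorem IsFusionClosed.mul_mem_coeffSpan {S : Set G.Irr} (hS : IsFusionClosed S) {a b : A}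
    (ha : a ∈ coeffSpan S) (hb : b ∈ coeffSpan S) : a * b ∈ coeffSpan S := by
  have hle : coeffSpan S * coeffSpan S ≤ coeffSpan S := by
    rw [coeffSpan, Submodule.span_mul_span, Submodule.span_le]
    rintro _ ⟨_, ⟨u, hu, i, j, rfl⟩, _, ⟨v, hv, k, l, rfl⟩, rfl⟩
    have hrep : G.IsRepOn (kronecker u.mat v.mat) := u.isRepOn.kronecker v.isRepOn
      fun a b => by rw [MinTensor.inl_mul_inr, MinTensor.inr_mul_inl]
    have hmem := hrep.mem_constituentSpan (i, k) (j, l)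
    refine Submodule.span_mono ?_ hmem
    rintro _ ⟨w, T, hT, hTI, x⟩
    exact ⟨w, hS.tensor_mem u v w hu hv ⟨T, hT, hTI⟩, x⟩
  exact hle (Submodule.mul_mem_mul ha hb)

/-- The span of the coefficients of a fusion-closed set of irreducible representations, as a
subalgebra. -/
noncomputable def IsFusionClosed.coeffSubalgebra {S : Set G.Irr} (hS : IsFusionClosed S) :
    Subalgebra ℂ A :=
  (coeffSpan S).toSubalgebra hS.one_mem_coeffSpan fun _ _ => hS.mul_mem_coeffSpan

theorem IsFusionClosed.mem_coeffSubalgebra {S : Set G.Irr} (hS : IsFusionClosed S) {a : A} :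
    a ∈ hS.coeffSubalgebra ↔ a ∈ coeffSpan S :=
  Iff.rfl

end CompactQuantumGroup

open Matrix in
/-- The inverse of a unitary matrix with entries in a finite-dimensional subalgebra has its entries
in that subalgebra. -/
theorem Matrix.conjTranspose_apply_mem_of_finiteDimensional {A : Type*} [Ring A] [StarRing A]
    [Algebra ℂ A] (V : Subalgebra ℂ A) [FiniteDimensional ℂ V] {ι : Type*} [Fintype ι]
    [DecidableEq ι] {u : Matrix ι ι A} (h : uᴴ * u = 1) (hu : ∀ i j, u i j ∈ V) (i j : ι) : uᴴ i j ∈ V := by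
  let u' : Matrix ι ι V := Matrix.of fun i j => ⟨u i j, hu i j⟩
  have hval : ∀ X : Matrix ι ι V, (u' * X).map V.val = u * X.map V.val := fun X => by
    rw [Matrix.map_mul]
    rfl
  -- Left multiplication by `u'` is an injective endomorphism of a finite-dimensional space, hence
  -- surjective; a preimage of `1` is the inverse over `V`.
  have hinj : Function.Injective (LinearMap.mulLeft ℂ u') := by
    intro X Y hXY
    have h1 := congrArg (fun Z : Matrix ι ι V => uᴴ * Z.map V.val) hXY
    simp only [LinearMap.mulLeft_apply, hval, ← Matrix.mul_assoc, h, Matrix.one_mul] at h1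
    exact Matrix.map_injective Subtype.val_injective h1
  obtain ⟨Y, hY⟩ := LinearMap.injective_iff_surjective.1 hinj 1
  have h2 : u * Y.map V.val = 1 := by
    rw [← hval, show u' * Y = 1 from hY]
    simp
  have h3 : uᴴ = Y.map V.val := by
    rw [← Matrix.one_mul (Y.map V.val), ← h, Matrix.mul_assoc, h2, Matrix.mul_one]
  rw [h3]
  exact (Y i j).2

/-! ### Exhaustion by finite-dimensional `*`-subalgebras and uniqueness of the norm -/

namespace CompactQuantumGroup

variable {A : Type*} [CStarAlgebra A] {H : Type*} [NormedAddCommGroup H]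
  [InnerProductSpace ℂ H] [CompleteSpace H] {G : CompactQuantumGroup A H}

/-- The adjoint of a coefficient of `u` is an entry of `uᴴ`, the inverse of `u`. This avoids proving
that the conjugate of `u` is equivalent to a unitary representation. -/
theorem IsFusionClosed.star_mem_coeffSpan {S : Set G.Irr} (hS : IsFusionClosed S)
    (hfin : S.Finite) {a : A} (ha : a ∈ coeffSpan S) : star a ∈ coeffSpan S := by
  have : FiniteDimensional ℂ hS.coeffSubalgebra := finiteDimensional_coeffSpan hfin
  induction ha using Submodule.span_induction with
  | mem x hx =>
    obtain ⟨u, hu, i, j, rfl⟩ := hx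
    exact Matrix.conjTranspose_apply_mem_of_finiteDimensional hS.coeffSubalgebra
      u.isRepOn.star_mul_self
      (fun k l => Submodule.subset_span ⟨u, hu, k, l, rfl⟩) j i
  | zero => simp
  | add x y _ _ hx hy => rw [star_add]; exact Submodule.add_mem _ hx hy
  | smul c x _ hx => rw [star_smul]; exact Submodule.smul_mem _ _ hx

theorem exists_finite_mem_coeffSpan {S : Set G.Irr} {a : A} (ha : a ∈ coeffSpan S) :
    ∃ I : Set G.Irr, I.Finite ∧ a ∈ coeffSpan I := by
  induction ha using Submodule.span_induction with
  | mem x hx =>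
    obtain ⟨u, -, i, j, rfl⟩ := hx
    exact ⟨{(⟦u⟧ : Quotient IrrRep.setoid)}, Set.finite_singleton _,
      Submodule.subset_span ⟨u, rfl, i, j, rfl⟩⟩
  | zero => exact ⟨∅, Set.finite_empty, Submodule.zero_mem _⟩
  | add x y _ _ hx hy =>
    obtain ⟨I, hI, hxI⟩ := hx
    obtain ⟨J, hJ, hyJ⟩ := hy
    exact ⟨I ∪ J, hI.union hJ, Submodule.add_mem _ (coeffSpan_mono Set.subset_union_left hxI)
      (coeffSpan_mono Set.subset_union_right hyJ)⟩
  | smul c x _ hx =>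
    obtain ⟨I, hI, hxI⟩ := hx
    exact ⟨I, hI, Submodule.smul_mem _ _ hxI⟩

/-- The coefficient spans of the `fusionClosure I`, `I` finite, form a directed family, so sums and
products can be taken inside the span for a union. -/
theorem DualLocallyFinite.exists_finite_mem (hG : G.DualLocallyFinite) {a : A} (ha : a ∈ G.pol) :
    ∃ I : Set G.Irr, I.Finite ∧ a ∈ coeffSpan (fusionClosure I) := by
  have hmono : ∀ {I J : Set G.Irr}, I ⊆ J →
      coeffSpan (fusionClosure I) ≤ coeffSpan (fusionClosure J) := fun h =>
    coeffSpan_mono (fusionClosure_mono h)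
  induction ha using StarAlgebra.adjoin_induction with
  | mem x hx =>
    obtain ⟨n, u, hu, i, j, rfl⟩ := hx
    have h1 := ((G.isUnitaryRep_iff u).1 hu).mem_constituentSpan i j
    have h2 : u i j ∈ coeffSpan (Set.univ : Set G.Irr) :=
      Submodule.span_mono (by
        rintro _ ⟨w, _, _, _, x⟩
        exact ⟨w, Set.mem_univ _, x⟩) h1
    obtain ⟨I, hI, h⟩ := exists_finite_mem_coeffSpan h2
    exact ⟨I, hI, coeffSpan_mono (subset_fusionClosure I) h⟩
  | algebraMap c =>
    refine ⟨∅, Set.finite_empty, ?_⟩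
    rw [Algebra.algebraMap_eq_smul_one]
    exact Submodule.smul_mem _ _ (IsFusionClosed.fusionClosure _).one_mem_coeffSpan
  | add x y _ _ hx hy =>
    obtain ⟨I, hI, hxI⟩ := hx
    obtain ⟨J, hJ, hyJ⟩ := hy
    exact ⟨I ∪ J, hI.union hJ, Submodule.add_mem _ (hmono Set.subset_union_left hxI)
      (hmono Set.subset_union_right hyJ)⟩
  | mul x y _ _ hx hy =>
    obtain ⟨I, hI, hxI⟩ := hx
    obtain ⟨J, hJ, hyJ⟩ := hy
    exact ⟨I ∪ J, hI.union hJ, (IsFusionClosed.fusionClosure _).mul_mem_coeffSpan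
      (hmono Set.subset_union_left hxI) (hmono Set.subset_union_right hyJ)⟩
  -- Local finiteness enters here: closure of the span under the adjoint rests on its finite
  -- dimension.
  | star x _ hx =>
    obtain ⟨I, hI, hxI⟩ := hx
    exact ⟨I, hI, (IsFusionClosed.fusionClosure I).star_mem_coeffSpan (hG I hI) hxI⟩

variable (G) in
/-- The restriction of the norm of `A` to `Pol(𝔾)`. -/
noncomputable def polNorm : AlgebraNorm ℂ G.pol where
  toFun x := ‖(x : A)‖
  map_zero' := norm_zero
  add_le' x y := norm_add_le (x : A) y
  neg' x := norm_neg (x : A)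
  mul_le' x y := norm_mul_le (x : A) y
  eq_zero_of_map_eq_zero' _ hx := Subtype.ext (norm_eq_zero.1 hx)
  smul' c x := norm_smul c (x : A)

theorem isPreCStarNorm_polNorm : IsPreCStarNorm G.polNorm := fun x => by
  change ‖star (x : A) * (x : A)‖ = ‖(x : A)‖ ^ 2
  rw [CStarRing.norm_star_mul_self, sq]

theorem DualLocallyFinite.le_of_isPreCStarNorm (hG : G.DualLocallyFinite)
    {p q : AlgebraNorm ℂ G.pol} (hp : IsPreCStarNorm p) (hq : IsPreCStarNorm q) (x : G.pol) :
    p x ≤ q x := by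
  obtain ⟨I, hI, hxI⟩ := hG.exists_finite_mem x.2
  have hS := IsFusionClosed.fusionClosure I
  have := finiteDimensional_coeffSpan (hG I hI)
  -- Pulling back to Pol(𝔾) makes it unnecessary to show that the span lies there; `f` embeds `V` in
  -- the span, whence finite dimension.
  let V : Subalgebra ℂ G.pol := hS.coeffSubalgebra.comap G.pol.subtype.toAlgHom
  let f : V →ₗ[ℂ] coeffSpan (fusionClosure I) :=
    { toFun := fun v => ⟨((v : G.pol) : A), v.2⟩
      map_add' := fun _ _ => rfl
      map_smul' := fun _ _ => rfl }
  have hf : Function.Injective f := fun v w h =>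
    Subtype.ext (Subtype.ext (congrArg (fun z : coeffSpan (fusionClosure I) => (z : A)) h))
  have : FiniteDimensional ℂ V := FiniteDimensional.of_injective f hf
  exact hp.le_of_mem hq V (fun y hy => hS.star_mem_coeffSpan (hG I hI) hy) hxI

end CompactQuantumGroup

theorem proposition2p12 {A : Type*} [CStarAlgebra A] [Nontrivial A]
    {H : Type*} [NormedAddCommGroup H] [InnerProductSpace ℂ H] [CompleteSpace H]
    (G : CompactQuantumGroup A H) (hG : G.DualLocallyFinite) :
    G.DualCStarUnique :=
  ⟨G.polNorm, CompactQuantumGroup.isPreCStarNorm_polNorm, fun _ hp =>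
    DFunLike.ext _ _ fun x =>
      le_antisymm (hG.le_of_isPreCStarNorm hp CompactQuantumGroup.isPreCStarNorm_polNorm x)
        (hG.le_of_isPreCStarNorm CompactQuantumGroup.isPreCStarNorm_polNorm hp x)⟩
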